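/- **Notation.** For a monad $\mathbb T=(T,m^T,u^T)$ on a category $\mathcal K$, let $\mathcal K_{\mathbb T}$ be its category of (Eilenberg–Moore) modules, with free functor $F_{\mathbb T}:\mathcal K\to\mathcal K_{\mathbb T}$, forgetful functor $U_{\mathbb T}:\mathcal K_{\mathbb T}\to\mathcal K$ and counit $\lambda^T:F_{\mathbb T}U_{\mathbb T}\to\mathcal K_{\mathbb T}$. Vertical composition of natural morphisms is written $\circ$, horizontal composition is juxtaposition, and a functor also denotes its identity morphism. Let $\mathcal K$ have equalizers and coequalizers, let $\alpha:\mathbb A\to\mathbb T$ and $\beta:\mathbb B\to\mathbb T$ be morphisms of monads on $\mathcal K$, and assume that the functors $A$ and $T$ preserve coequalizers. Let $R_A:\mathcal K_{\mathbb T}\to\mathcal K_{\mathbb A}$, $(X,x)\mapsto (X,x\circ\alpha X)$, and let $(N_A,\chi^A)$ be the coequalizer of $(\lambda^TF_{\mathbb T}U_{\mathbb A})\circ(F_{\mathbb T}\alpha U_{\mathbb A})$ and $F_{\mathbb T}U_{\mathbb A}\lambda^A$, as functors $\mathcal K_{\mathbb A}\to\mathcal K_{\mathbb T}$. Then $N_A$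 is left adjoint to $R_A$, with unit $\eta^A$ and counit $\epsilon^A$ determined by $U_{\mathbb A}\eta^A=(U_{\mathbb T}\chi^A)\circ(u^TU_{\mathbb A})$ and $\epsilon^A\circ(\chi^AR_A)=\lambda^T$. Define $(N_B,R_B)$, $\chi^B$, $\eta^B$, $\epsilon^B$ in the same way from $\beta$. * An object $(\mathcal K_{\mathbb T},(N_A,R_A),(N_B,R_B),\mathbb C,\xi)$ of $\mathrm{RArr}(\mathcal K_{\mathbb A},\mathcal K_{\mathbb B})$ consists of a comonad $\mathbb C=(C,\Delta,\varepsilon)$ on $\mathcal K_{\mathbb A}$ and a natural isomorphism $\xi:CR_A\to R_AN_BR_B$ such that $(R_A\epsilon^B)\circ\xi=\varepsilon R_A$ and $(R_AN_B\eta^BR_B)\circ\xi=(\xi N_BR_B)\circ(C\xi)\circ(\Delta R_A)$. * A lifting of a comonad $\mathbb C$ on $\mathcal K_{\mathbb A}$ to $\mathcal K_{\mathbb T}$ is a comonad $\mathbb G=(G,\Delta^G,\varepsilon^G)$ on $\mathcal K_{\mathbb T}$ with $R_AG=CR_A$, $R_A\Delta^G=\Delta R_A$ and $R_A\varepsilon^G=\varepsilon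 R_A$. * A right $\mathbb G$-coaction on $U_{\mathbb T}$ is a natural morphism $g:U_{\mathbb T}\to U_{\mathbb T}G$ with $(U_{\mathbb T}\varepsilon^G)\circ g=U_{\mathbb T}$ and $(U_{\mathbb T}\Delta^G)\circ g=(gG)\circ g$. Put $\overline g:=(\lambda^TGF_{\mathbb T})\circ(F_{\mathbb T}gF_{\mathbb T})\circ(F_{\mathbb T}u^T):F_{\mathbb T}\to GF_{\mathbb T}$. One says that $\mathbb B=\mathbb T^{Co(G,g)}$ (the coinvariant monad) with canonical inclusion $\beta$ if $(B,\beta)$ is the equalizer of $gF_{\mathbb T}$ and $U_{\mathbb T}\overline g$ in the category of functors $\mathcal K\to\mathcal K$. In this case there is a unique natural morphism $\overline h:N_B\to GN_B$ with $\overline h\circ\chi^B=(G\chi^B)\circ(\overline gU_{\mathbb B})$, and the canonical comonad morphism is $\mathrm{can}:=(G\epsilon^B)\circ(\overline hR_B):N_BR_B\to G$. **Theorem.** In this setting, assume furthermore that $\eta^B$ is a regular monomorphism in the category of functors $\mathcal K_{\mathbb B}\to\mathcal K_{\mathbb B}$. Then there is a bijective correspondence between (a) objects $(\mathcal K_{\mathbb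 T},(N_A,R_A),(N_B,R_B),\mathbb C,\xi)$ of $\mathrm{RArr}(\mathcal K_{\mathbb A},\mathcal K_{\mathbb B})$, and (b) triples $(\mathbb C,\mathbb G,g)$ consisting of a comonad $\mathbb C$ on $\mathcal K_{\mathbb A}$, a lifting $\mathbb G$ of $\mathbb C$ to $\mathcal K_{\mathbb T}$ and a right $\mathbb G$-coaction $g:U_{\mathbb T}\to U_{\mathbb T}G$ such that $\mathbb B=\mathbb T^{Co(G,g)}$ with canonical inclusion $\beta$, and $\mathrm{can}:N_BR_B\to G$ is an isomorphism. The correspondence preserves $\mathbb C$, and if $(\mathbb C,\xi)$ corresponds to $(\mathbb C,\mathbb G,g)$, then $R_A\,\mathrm{can}=\xi^{-1}$ and $g=(U_{\mathbb T}\,\mathrm{can})\circ(U_{\mathbb B}\eta^BR_B)$. -/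

import Mathlib

open CategoryTheory CategoryTheory.Limits

universe v u v₁ u₁ v₂ u₂ v₃ u₃

namespace GaloisComonad

section ComonadNotions

variable {𝒜 : Type u₁} [Category.{v₁} 𝒜] {ℬ : Type u₂} [Category.{v₂} ℬ]
  {𝒯 : Type u₃} [Category.{v₃} 𝒯]

/-- `(F, ξ)` is a comonad arrow from the comonad `C` on `𝒜` to the comonad `C'` on `𝒯`:
`F : 𝒯 ⥤ 𝒜` is a functor and `ξ : C F ⟶ F C'` is compatible with counits and coproducts. -/
structure IsComonadArrow (C : Comonad 𝒜) (C' : Comonad 𝒯) (F : 𝒯 ⥤ 𝒜)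
    (ξ : F ⋙ C.toFunctor ⟶ C'.toFunctor ⋙ F) : Prop where
  counit : ∀ X : 𝒯, ξ.app X ≫ F.map (C'.ε.app X) = C.ε.app (F.obj X)
  comul : ∀ X : 𝒯, ξ.app X ≫ F.map (C'.δ.app X) =
    C.δ.app (F.obj X) ≫ C.map (ξ.app X) ≫ ξ.app (C'.obj X)

/-- The objects `(𝒯, (N_A, R_A), (N_B, R_B), C, ξ)` of the category `RArr(𝒜, ℬ)` with prescribed
category `𝒯` and prescribed adjunctions `N_A ⊣ R_A`, `N_B ⊣ R_B`: a comonad `C` on `𝒜` and a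
natural isomorphism `ξ : C R_A ⟶ R_A (N_B R_B)` such that `(R_A, ξ)` is a comonad arrow from `C` to
the comonad `N_B R_B` on `𝒯`. -/
structure RArrOver {N_A : 𝒜 ⥤ 𝒯} {R_A : 𝒯 ⥤ 𝒜} {N_B : ℬ ⥤ 𝒯} {R_B : 𝒯 ⥤ ℬ}
    (adjA : N_A ⊣ R_A) (adjB : N_B ⊣ R_B) where
  C : Comonad 𝒜
  ξ : R_A ⋙ C.toFunctor ⟶ adjB.toComonad.toFunctor ⋙ R_A
  isComonadArrow : IsComonadArrow C adjB.toComonad R_A ξ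
  isRegular : IsIso ξ

/-- The comonad `G` on `𝒯` is a (strict) lifting of the comonad `C` on `𝒜` along `R : 𝒯 ⥤ 𝒜`:
`R G = C R`, `R Δ^G = Δ^C R` and `R ε^G = ε^C R`. -/
structure IsLifting (R : 𝒯 ⥤ 𝒜) (C : Comonad 𝒜) (G : Comonad 𝒯) : Prop where
  comp_eq : G.toFunctor ⋙ R = R ⋙ C.toFunctor
  comul : ∀ X : 𝒯, R.map (G.δ.app X) =
    eqToHom (Functor.congr_obj comp_eq X) ≫ C.δ.app (R.obj X) ≫
      eqToHom ((congrArg C.obj (Functor.congr_obj comp_eq X)).symm.trans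
        (Functor.congr_obj comp_eq (G.obj X)).symm)
  counit : ∀ X : 𝒯, R.map (G.ε.app X) =
    eqToHom (Functor.congr_obj comp_eq X) ≫ C.ε.app (R.obj X)

/-- `r : R ⟶ R G` is a right coaction of the comonad `G` on the functor `R`. -/
structure IsRightCoaction (G : Comonad 𝒯) (R : 𝒯 ⥤ 𝒜) (r : R ⟶ G.toFunctor ⋙ R) : Prop where
  counit : ∀ X : 𝒯, r.app X ≫ R.map (G.ε.app X) = 𝟙 (R.obj X)
  coassoc : ∀ X : 𝒯, r.app X ≫ R.map (G.δ.app X) = r.app X ≫ r.app (G.obj X)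

/-- For an adjunction `L ⊣ R` and `g : R ⟶ R G`, the induced morphism
`ḡ = (ε G L) ∘ (L g L) ∘ (L η) : L ⟶ G L`. -/
def leftCoaction {L : 𝒜 ⥤ 𝒯} {R : 𝒯 ⥤ 𝒜} (adj : L ⊣ R) (G : Comonad 𝒯)
    (g : R ⟶ G.toFunctor ⋙ R) : L ⟶ L ⋙ G.toFunctor where
  app X := L.map (adj.unit.app X) ≫ L.map (g.app (L.obj X)) ≫ adj.counit.app (G.obj (L.obj X))
  naturality X Y f := by
    have h1 := adj.unit.naturality f
    have h2 := g.naturality (L.map f)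
    have h3 := adj.counit.naturality (G.map (L.map f))
    dsimp at h1 h2 h3 ⊢
    simp only [Category.assoc]
    rw [← L.map_comp_assoc, h1, L.map_comp_assoc, ← L.map_comp_assoc (R.map (L.map f)), h2,
      L.map_comp_assoc, h3]

end ComonadNotions

section MonadMorphism

variable {K : Type u} [Category.{v} K] {A T : CategoryTheory.Monad K}

/-- The functor `R_A : K_T ⥤ K_A`, `(X, x) ↦ (X, x ∘ α X)`, induced by a monad morphism
`α : A ⟶ T`. -/
abbrev restr (α : A ⟶ T) : T.Algebra ⥤ A.Algebra := Monad.algebraFunctorOfMonadHom α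

/-- The counit `λ^T : F_T U_T ⟶ K_T`, at `M`. -/
def lam (M : T.Algebra) : T.free.obj M.A ⟶ M := T.adj.counit.app M

/-- The right `A`-action `(λ^T F_T U_A) ∘ (F_T α U_A) : F_T A U_A ⟶ F_T U_A`, at `Y`. -/
def actL (α : A ⟶ T) (Y : A.Algebra) : T.free.obj (A.obj Y.A) ⟶ T.free.obj Y.A :=
  T.free.map (α.app Y.A) ≫ lam (T.free.obj Y.A)

/-- The morphism `F_T U_A λ^A : F_T A U_A ⟶ F_T U_A`, at `Y`. -/
def actR (T : CategoryTheory.Monad K) (Y : A.Algebra) :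
    T.free.obj (A.obj Y.A) ⟶ T.free.obj Y.A :=
  T.free.map Y.a

/-- The morphism of `K` underlying a morphism out of a free module. -/
def und {X : K} {M : T.Algebra} (k : T.free.obj X ⟶ M) : T.obj X ⟶ M.A := k.f

/-- The restriction along the unit of a morphism out of a free module. -/
def res {X : K} {M : T.Algebra} (k : T.free.obj X ⟶ M) : X ⟶ M.A :=
  T.η.app X ≫ und k

theorem und_eq_res {X : K} {M : T.Algebra} (k : T.free.obj X ⟶ M) :
    und k = T.map (res k) ≫ M.a := by
  have h : T.map (und k) ≫ M.a = T.μ.app X ≫ und k := k.h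
  have e : T.map (T.η.app X) ≫ T.μ.app X = 𝟙 (T.obj X) := T.right_unit X
  rw [res, T.map_comp, Category.assoc, h, reassoc_of% e]

/-- A morphism out of a free module is determined by its restriction along the unit. -/
theorem res_injective {X : K} {M : T.Algebra} {h k : T.free.obj X ⟶ M} (w : res h = res k) :
    h = k := by
  apply Monad.Algebra.Hom.ext'
  change und h = und k
  rw [und_eq_res, und_eq_res, w]

theorem res_comp {X : K} {M N : T.Algebra} (k : T.free.obj X ⟶ M) (l : M ⟶ N) :
    res (k ≫ l) = res k ≫ l.f :=
  (Category.assoc (T.η.app X) (und k) l.f).symm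

theorem res_map_comp {X Y : K} {M : T.Algebra} (h : X ⟶ Y) (k : T.free.obj Y ⟶ M) :
    res (T.free.map h ≫ k) = h ≫ res k := by
  change T.η.app X ≫ T.map h ≫ und k = h ≫ T.η.app Y ≫ und k
  exact (Category.assoc _ _ _).symm.trans
    ((congrArg (fun t => t ≫ und k) (T.η.naturality h).symm).trans (Category.assoc _ _ _))

theorem und_lam (M : T.Algebra) : und (lam M) = M.a := by
  have h : (T.adj.counit.app M).f = M.a := by
    rw [Monad.adj_counit]
  exact h

theorem res_lam (M : T.Algebra) : res (lam M) = 𝟙 M.A := by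
  rw [res, und_lam, M.unit]

theorem res_actL_comp (α : A ⟶ T) (Y : A.Algebra) {M : T.Algebra} (k : T.free.obj Y.A ⟶ M) :
    res (actL α Y ≫ k) = α.app Y.A ≫ T.map (res k) ≫ M.a := by
  have h : res (lam (T.free.obj Y.A) ≫ k) = und k := by
    rw [res_comp, res_lam]
    exact Category.id_comp _
  have h2 : res (T.free.map (α.app Y.A) ≫ lam (T.free.obj Y.A) ≫ k) =
    α.app Y.A ≫ res (lam (T.free.obj Y.A) ≫ k) := res_map_comp _ _
  exact (congrArg res (Category.assoc _ _ _)).trans (h2.trans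
    (congrArg (fun t => α.app Y.A ≫ t) (h.trans (und_eq_res k))))

theorem res_actR_comp (Y : A.Algebra) {M : T.Algebra} (k : T.free.obj Y.A ⟶ M) :
    res (actR T Y ≫ k) = Y.a ≫ res k :=
  res_map_comp _ _

/-- A morphism out of `F_T U_A Y` coequalizes the two actions if and only if its restriction is
`A`-linear. -/
theorem act_coequalizes_iff (α : A ⟶ T) (Y : A.Algebra) {M : T.Algebra}
    (k : T.free.obj Y.A ⟶ M) :
    actL α Y ≫ k = actR T Y ≫ k ↔ α.app Y.A ≫ T.map (res k) ≫ M.a = Y.a ≫ res k := by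
  rw [← res_actL_comp, ← res_actR_comp]
  exact ⟨fun h => by rw [h], res_injective⟩

theorem comp_aux {V X Y Z : K} {a : V ⟶ X} {b : X ⟶ Y} {f : V ⟶ Z} {c : Z ⟶ Y} {d : Y ⟶ Z}
    (h1 : a ≫ b = f ≫ c) (h3 : c ≫ d = 𝟙 Z) : a ≫ b ≫ d = f := by
  rw [reassoc_of% h1, h3, Category.comp_id]

theorem comp_aux' {X Y Z : K} {a : X ⟶ Y} {b : Y ⟶ X} {f : X ⟶ Z} (h : a ≫ b = 𝟙 X) :
    a ≫ b ≫ f = f := by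
  rw [reassoc_of% h]

theorem comp_aux'' {V X Y Z : K} {a : V ⟶ X} {b : X ⟶ Y} {f : V ⟶ Z} {c : Z ⟶ Y} {d : Y ⟶ Z}
    (h1 : a ≫ b = f ≫ c) (h3 : c ≫ d = 𝟙 Z) : a ≫ b ≫ d = f ≫ 𝟙 Z := by
  rw [reassoc_of% h1, h3]

variable [HasCoequalizers K] [PreservesColimitsOfShape WalkingParallelPair T.toFunctor]

instance hasCoequalizers_algebra : HasCoequalizers T.Algebra :=
  hasColimitsOfShape_of_hasColimitsOfShape_createsColimitsOfShape T.forget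

/-- `N_A Y`, the coequalizer of the two actions `F_T A U_A Y ⇉ F_T U_A Y` in `K_T`. -/
noncomputable def inducedObj (α : A ⟶ T) (Y : A.Algebra) : T.Algebra :=
  coequalizer (actL α Y) (actR T Y)

/-- The defining epimorphism `χ^A : F_T U_A ⟶ N_A`, at `Y`. -/
noncomputable def χ (α : A ⟶ T) (Y : A.Algebra) : T.free.obj Y.A ⟶ inducedObj α Y :=
  coequalizer.π (actL α Y) (actR T Y)

theorem χ_condition (α : A ⟶ T) (Y : A.Algebra) : actL α Y ≫ χ α Y = actR T Y ≫ χ α Y :=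
  coequalizer.condition _ _

/-- The morphism out of `N_A Y` induced by a morphism coequalizing the two actions. -/
noncomputable def χdesc (α : A ⟶ T) (Y : A.Algebra) {M : T.Algebra} (k : T.free.obj Y.A ⟶ M)
    (h : actL α Y ≫ k = actR T Y ≫ k) : inducedObj α Y ⟶ M :=
  coequalizer.desc k h

theorem χ_desc (α : A ⟶ T) (Y : A.Algebra) {M : T.Algebra} (k : T.free.obj Y.A ⟶ M)
    (h : actL α Y ≫ k = actR T Y ≫ k) : χ α Y ≫ χdesc α Y k h = k :=
  coequalizer.π_desc _ _

theorem χ_ext (α : A ⟶ T) {Y : A.Algebra} {M : T.Algebra} {h k : inducedObj α Y ⟶ M}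
    (w : res (χ α Y) ≫ h.f = res (χ α Y) ≫ k.f) : h = k :=
  coequalizer.hom_ext (res_injective ((res_comp _ _).trans (w.trans (res_comp _ _).symm)))

theorem inducedMap_aux (α : A ⟶ T) {Y Z : A.Algebra} (f : Y ⟶ Z) :
    actL α Y ≫ T.free.map f.f ≫ χ α Z = actR T Y ≫ T.free.map f.f ≫ χ α Z := by
  have h := (act_coequalizes_iff α Z (χ α Z)).1 (χ_condition α Z)
  have n := α.naturality f.f
  rw [act_coequalizes_iff, res_map_comp, T.map_comp, Category.assoc, ← reassoc_of% n, h,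
    ← Category.assoc, f.h, Category.assoc]

/-- The functor `N_A : K_A ⥤ K_T`, the coequalizer of `F_T A U_A ⇉ F_T U_A` in the category of
functors, computed objectwise: on morphisms, `N_A f ∘ χ^A Y = χ^A Z ∘ F_T U_A f`. -/
noncomputable def induced (α : A ⟶ T) : A.Algebra ⥤ T.Algebra where
  obj Y := inducedObj α Y
  map {Y Z} f := χdesc α Y (T.free.map f.f ≫ χ α Z) (inducedMap_aux α f)
  map_id Y := χ_ext α (by
    rw [← res_comp, χ_desc, res_map_comp]
    exact (Category.id_comp _).trans (Category.comp_id _).symm)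
  map_comp {X Y Z} f g := χ_ext α (by
    have h1 : res (χ α X) ≫ (χdesc α X (T.free.map f.f ≫ χ α Y) (inducedMap_aux α f)).f =
        f.f ≫ res (χ α Y) := by
      rw [← res_comp, χ_desc, res_map_comp]
    have h2 : res (χ α Y) ≫ (χdesc α Y (T.free.map g.f ≫ χ α Z) (inducedMap_aux α g)).f =
        g.f ≫ res (χ α Z) := by
      rw [← res_comp, χ_desc, res_map_comp]
    rw [← res_comp, χ_desc, res_map_comp, Monad.Algebra.comp_f, Monad.Algebra.comp_f,
      reassoc_of% h1, h2, Category.assoc])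

theorem res_χ_map (α : A ⟶ T) {Y Z : A.Algebra} (f : Y ⟶ Z) :
    res (χ α Y) ≫ ((induced α).map f).f = f.f ≫ res (χ α Z) :=
  (res_comp _ _).symm.trans ((congrArg res (χ_desc _ _ _ _)).trans (res_map_comp _ _))

/-- The unit `η^A` of the canonical adjunction, with `U_A η^A = (U_T χ^A) ∘ (u^T U_A)`, at `Y`. -/
noncomputable def unitApp (α : A ⟶ T) (Y : A.Algebra) :
    Y ⟶ (restr α).obj ((induced α).obj Y) where
  f := T.η.app Y.A ≫ (χ α Y).f
  h := by
    have h := (act_coequalizes_iff α Y (χ α Y)).1 (χ_condition α Y)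
    have n := α.naturality (res (χ α Y))
    change A.map (res (χ α Y)) ≫ α.app _ ≫ (inducedObj α Y).a = Y.a ≫ res (χ α Y)
    rw [reassoc_of% n, h]

/-- The counit `ε^A` of the canonical adjunction, with `ε^A ∘ (χ^A R_A) = λ^T`, at `M`. -/
noncomputable def counitApp (α : A ⟶ T) (M : T.Algebra) :
    (induced α).obj ((restr α).obj M) ⟶ M :=
  χdesc α ((restr α).obj M) (lam M) ((act_coequalizes_iff α ((restr α).obj M) (lam M)).2 (by
    have h := res_lam M
    change α.app M.A ≫ T.map (res (lam M)) ≫ M.a = (α.app M.A ≫ M.a) ≫ res (lam M)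
    rw [h]
    simp))

theorem res_χ_counitApp (α : A ⟶ T) (M : T.Algebra) :
    res (χ α ((restr α).obj M)) ≫ (counitApp α M).f = 𝟙 M.A :=
  (res_comp _ _).symm.trans ((congrArg res (χ_desc _ _ _ _)).trans (res_lam M))

/-- The canonical adjunction `N_A ⊣ R_A` associated to a monad morphism `α : A ⟶ T`. -/
noncomputable def canonicalAdj (α : A ⟶ T) : induced α ⊣ restr α :=
  Adjunction.mkOfUnitCounit
    { unit :=
        { app := unitApp α
          naturality := fun Y Z f => Monad.Algebra.Hom.ext' _ _ _ _ (res_χ_map α f).symm }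
      counit :=
        { app := counitApp α
          naturality := fun M N f => χ_ext α (by
            have h1 := res_χ_map α ((restr α).map f)
            have h2 := res_χ_counitApp α M
            have h3 := res_χ_counitApp α N
            exact (comp_aux h1 h3).trans (comp_aux' h2).symm) }
      left_triangle := NatTrans.ext (funext fun Y => χ_ext α (by
        have h1 := res_χ_map α (unitApp α Y)
        have h2 := res_χ_counitApp α ((induced α).obj Y)
        have h3 : ((induced α).map (unitApp α Y)).f ≫
            𝟙 _ ≫ (counitApp α ((induced α).obj Y)).f = ((induced α).map (unitApp α Y)).f ≫
              (counitApp α ((induced α).obj Y)).f :=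
          congrArg (fun t => ((induced α).map (unitApp α Y)).f ≫ t) (Category.id_comp _)
        exact (congrArg (fun t => res (χ α Y) ≫ t) h3).trans (comp_aux'' h1 h2)))
      right_triangle := NatTrans.ext (funext fun M => Monad.Algebra.Hom.ext' _ _ _ _ (by
        have h2 := res_χ_counitApp α M
        exact (congrArg (fun t => res (χ α ((restr α).obj M)) ≫ t) (Category.id_comp _)).trans h2)) }

end MonadMorphism

section Coinvariants

variable {K : Type u} [Category.{v} K] {A B T : CategoryTheory.Monad K}

/-- The morphism `g F_T : T = U_T F_T ⟶ U_T G F_T`. -/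
def coactFree {G : Comonad T.Algebra} (g : T.forget ⟶ G.toFunctor ⋙ T.forget) :
    T.toFunctor ⟶ T.free ⋙ G.toFunctor ⋙ T.forget :=
  Functor.whiskerLeft T.free g

/-- The morphism `U_T ḡ : T = U_T F_T ⟶ U_T G F_T`. -/
def coactFree' {G : Comonad T.Algebra} (g : T.forget ⟶ G.toFunctor ⋙ T.forget) :
    T.toFunctor ⟶ T.free ⋙ G.toFunctor ⋙ T.forget :=
  Functor.whiskerRight (leftCoaction T.adj G g) T.forget

/-- `B` is the coinvariant monad `T^{Co(G,g)}`, with canonical inclusion the monad morphism `β`: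
the pair `(B, β)` is an equalizer of `g F_T` and `U_T ḡ` in the category of endofunctors of `K`. -/
def IsCoinvariantMonad (β : B ⟶ T) {G : Comonad T.Algebra}
    (g : T.forget ⟶ G.toFunctor ⋙ T.forget) : Prop :=
  ∃ w : β.toNatTrans ≫ coactFree g = β.toNatTrans ≫ coactFree' g,
    Nonempty (IsLimit (Fork.ofι (f := coactFree g) (g := coactFree' g) β.toNatTrans w))

theorem res_leftCoaction {G : Comonad T.Algebra} (g : T.forget ⟶ G.toFunctor ⋙ T.forget) (X : K) :
    res ((leftCoaction T.adj G g).app X) = T.η.app X ≫ g.app (T.free.obj X) := by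
  have h1 : res (T.free.map (T.adj.unit.app X) ≫ T.free.map (g.app (T.free.obj X)) ≫
      lam (G.obj (T.free.obj X))) = T.adj.unit.app X ≫ res (T.free.map (g.app (T.free.obj X)) ≫
      lam (G.obj (T.free.obj X))) := res_map_comp _ _
  have h2 : res (T.free.map (g.app (T.free.obj X)) ≫ lam (G.obj (T.free.obj X))) =
      g.app (T.free.obj X) ≫ res (lam (G.obj (T.free.obj X))) := res_map_comp _ _
  have h3 : g.app (T.free.obj X) ≫ 𝟙 (G.obj (T.free.obj X)).A = g.app (T.free.obj X) :=
    Category.comp_id _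
  have h4 : T.adj.unit.app X = T.η.app X := by rw [Monad.adj_unit]
  refine h1.trans ((congrArg (fun t => T.adj.unit.app X ≫ t) (h2.trans ?_)).trans
    (congrArg (fun t => t ≫ g.app (T.free.obj X)) h4))
  exact (congrArg (fun t => g.app (T.free.obj X) ≫ t) (res_lam _)).trans h3

theorem actL_leftCoaction {β : B ⟶ T} {G : Comonad T.Algebra}
    {g : T.forget ⟶ G.toFunctor ⋙ T.forget}
    (w : β.toNatTrans ≫ coactFree g = β.toNatTrans ≫ coactFree' g) (Y : B.Algebra) :
    actL β Y ≫ (leftCoaction T.adj G g).app Y.A =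
      (leftCoaction T.adj G g).app (B.obj Y.A) ≫ G.map (actL β Y) := by
  apply res_injective
  have hw : β.app Y.A ≫ g.app (T.free.obj Y.A) =
      β.app Y.A ≫ und ((leftCoaction T.adj G g).app Y.A) := NatTrans.congr_app w Y.A
  have hL : res (actL β Y) = β.app Y.A :=
    (res_map_comp _ _).trans ((congrArg (fun t => β.app Y.A ≫ t) (res_lam _)).trans
      (Category.comp_id _))
  have hn : und (actL β Y) ≫ g.app (T.free.obj Y.A) =
      g.app (T.free.obj (B.obj Y.A)) ≫ (G.map (actL β Y)).f := g.naturality (actL β Y)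
  have h1 : res (actL β Y ≫ (leftCoaction T.adj G g).app Y.A) =
      β.app Y.A ≫ und ((leftCoaction T.adj G g).app Y.A) := by
    rw [und_eq_res]
    exact res_actL_comp β Y _
  have h2 : res ((leftCoaction T.adj G g).app (B.obj Y.A) ≫ G.map (actL β Y)) =
      β.app Y.A ≫ g.app (T.free.obj Y.A) := by
    refine (res_comp _ _).trans ?_
    rw [res_leftCoaction, ← hL]
    exact (Category.assoc _ _ _).trans
      ((congrArg (fun t => T.η.app (B.obj Y.A) ≫ t) hn.symm).trans (Category.assoc _ _ _).symm)
  rw [h1, h2, hw]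

variable [HasCoequalizers K] [PreservesColimitsOfShape WalkingParallelPair T.toFunctor]

theorem inducedCoaction_aux {β : B ⟶ T} {G : Comonad T.Algebra}
    {g : T.forget ⟶ G.toFunctor ⋙ T.forget} (hg : IsCoinvariantMonad β g) (Y : B.Algebra) :
    actL β Y ≫ (leftCoaction T.adj G g).app Y.A ≫ G.map (χ β Y) =
      actR T Y ≫ (leftCoaction T.adj G g).app Y.A ≫ G.map (χ β Y) := by
  obtain ⟨w, -⟩ := hg
  have h1 := actL_leftCoaction w Y
  have h2 : actR T Y ≫ (leftCoaction T.adj G g).app Y.A =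
      (leftCoaction T.adj G g).app (B.obj Y.A) ≫ G.map (actR T Y) :=
    (leftCoaction T.adj G g).naturality Y.a
  have h3 : G.map (actL β Y) ≫ G.map (χ β Y) = G.map (actR T Y) ≫ G.map (χ β Y) :=
    (G.map_comp _ _).symm.trans ((congrArg G.map (χ_condition β Y)).trans (G.map_comp _ _))
  calc _ = (actL β Y ≫ (leftCoaction T.adj G g).app Y.A) ≫ G.map (χ β Y) :=
        (Category.assoc _ _ _).symm
    _ = (leftCoaction T.adj G g).app (B.obj Y.A) ≫ G.map (actL β Y) ≫ G.map (χ β Y) :=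
        (congrArg (fun t => t ≫ G.map (χ β Y)) h1).trans (Category.assoc _ _ _)
    _ = (leftCoaction T.adj G g).app (B.obj Y.A) ≫ G.map (actR T Y) ≫ G.map (χ β Y) :=
        congrArg (fun t => (leftCoaction T.adj G g).app (B.obj Y.A) ≫ t) h3
    _ = (actR T Y ≫ (leftCoaction T.adj G g).app Y.A) ≫ G.map (χ β Y) :=
        ((congrArg (fun t => t ≫ G.map (χ β Y)) h2).trans (Category.assoc _ _ _)).symm
    _ = _ := Category.assoc _ _ _

/-- The left `G`-coaction `h̄ : N_B ⟶ G N_B`, the unique natural morphism such that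
`h̄ ∘ χ^B = (G χ^B) ∘ (ḡ U_B)`. -/
noncomputable def inducedCoaction {β : B ⟶ T} {G : Comonad T.Algebra}
    {g : T.forget ⟶ G.toFunctor ⋙ T.forget} (hg : IsCoinvariantMonad β g) :
    induced β ⟶ induced β ⋙ G.toFunctor where
  app Y := χdesc β Y ((leftCoaction T.adj G g).app Y.A ≫ G.map (χ β Y)) (inducedCoaction_aux hg Y)
  naturality Y Z f := by
    have h1 : χ β Y ≫ (induced β).map f = T.free.map f.f ≫ χ β Z := χ_desc _ _ _ _
    have h2 : T.free.map f.f ≫ (leftCoaction T.adj G g).app Z.A =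
        (leftCoaction T.adj G g).app Y.A ≫ G.map (T.free.map f.f) :=
      (leftCoaction T.adj G g).naturality f.f
    have h3 := χ_desc β Y _ (inducedCoaction_aux hg Y)
    have h4 := χ_desc β Z _ (inducedCoaction_aux hg Z)
    refine coequalizer.hom_ext ?_
    change χ β Y ≫ (induced β).map f ≫ χdesc β Z _ (inducedCoaction_aux hg Z) =
      χ β Y ≫ χdesc β Y _ (inducedCoaction_aux hg Y) ≫ G.map ((induced β).map f)
    have a1 : χ β Y ≫ (induced β).map f ≫ χdesc β Z _ (inducedCoaction_aux hg Z) =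
        (T.free.map f.f ≫ χ β Z) ≫ χdesc β Z _ (inducedCoaction_aux hg Z) :=
      (Category.assoc _ _ _).symm.trans
        (congrArg (fun t => t ≫ χdesc β Z _ (inducedCoaction_aux hg Z)) h1)
    have a2 : (T.free.map f.f ≫ χ β Z) ≫ χdesc β Z _ (inducedCoaction_aux hg Z) =
        T.free.map f.f ≫ (leftCoaction T.adj G g).app Z.A ≫ G.map (χ β Z) :=
      (Category.assoc _ _ _).trans (congrArg (fun t => T.free.map f.f ≫ t) h4)
    have a3 : T.free.map f.f ≫ (leftCoaction T.adj G g).app Z.A ≫ G.map (χ β Z) =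
        (leftCoaction T.adj G g).app Y.A ≫ G.map (T.free.map f.f) ≫ G.map (χ β Z) :=
      (Category.assoc _ _ _).symm.trans
        ((congrArg (fun t => t ≫ G.map (χ β Z)) h2).trans (Category.assoc _ _ _))
    have a4 : G.map (T.free.map f.f) ≫ G.map (χ β Z) =
        G.map (χ β Y) ≫ G.map ((induced β).map f) :=
      (G.map_comp _ _).symm.trans ((congrArg G.map h1.symm).trans (G.map_comp _ _))
    have a5 : (leftCoaction T.adj G g).app Y.A ≫ G.map (χ β Y) ≫ G.map ((induced β).map f) =
        χ β Y ≫ χdesc β Y _ (inducedCoaction_aux hg Y) ≫ G.map ((induced β).map f) :=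
      (Category.assoc _ _ _).symm.trans
        ((congrArg (fun t => t ≫ G.map ((induced β).map f)) h3.symm).trans (Category.assoc _ _ _))
    exact a1.trans (a2.trans (a3.trans
      ((congrArg (fun t => (leftCoaction T.adj G g).app Y.A ≫ t) a4).trans a5)))

/-- The canonical comonad morphism `can = (G ε^B) ∘ (h̄ R_B) : N_B R_B ⟶ G`. -/
noncomputable def can {β : B ⟶ T} {G : Comonad T.Algebra}
    {g : T.forget ⟶ G.toFunctor ⋙ T.forget} (hg : IsCoinvariantMonad β g) :
    restr β ⋙ induced β ⟶ G.toFunctor :=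
  Functor.whiskerLeft (restr β) (inducedCoaction hg) ≫
    Functor.whiskerRight (canonicalAdj β).counit G.toFunctor

/-- A comonad `C` on `K_A`, a lifting of `C` along `R_A` to a comonad `G` on `K_T`, and a right
coaction `g : U_T ⟶ U_T G`, such that `B` is the coinvariant monad `T^{Co(G,g)}` with canonical
inclusion `β`, and the canonical comonad morphism `N_B R_B ⟶ G` is an isomorphism. -/
structure GaloisCoaction (α : A ⟶ T) (β : B ⟶ T) where
  C : Comonad A.Algebra
  G : Comonad T.Algebra
  isLifting : IsLifting (restr α) C G
  g : T.forget ⟶ G.toFunctor ⋙ T.forget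
  isRightCoaction : IsRightCoaction G T.forget g
  isCoinvariant : IsCoinvariantMonad β g
  isIso_can : IsIso (can isCoinvariant)

end Coinvariants

end GaloisComonad

/-! Two translations carry the theorem, with a comonad isomorphism κ : N_B R_B ≅ G in the middle.

Between κ and ξ: given an invertible ξ, the T-module structure of N_B R_B M is transported along ξ M
to the object underlying C R_A M. As ξ M is A-linear, the new module restricts to C R_A M on the
nose (`restr_transportAlgebra`). This gives a strict lifting G together with κ lying over ξ⁻¹, and
compatibility of ξ with the comonad structures makes G lift C as a comonad (`isLifting_of_iso`).
Conversely, ξ is the inverse of R_A κ (`isComonadArrow_arrowOfIso`).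

Between κ and g: composing κ with the unit η^B R_B gives g, and `can` is the only morphism giving
back g (`unitRestr_can`, `unitRestr_ext`). Under this transposition the coaction axioms for g are
the comonad morphism axioms for κ.

It remains to see that such a g has B as its coinvariants. There is a section F_T ⟶ N_B F_B of the
canonical map back, and it carries β to η^B F_B (`app_freeToInduced`). Cancelling κ, a morphism
equalizing g F_T and U_T ḡ is sent by this section to one equalizing the two whiskerings of η^B.
When η^B is a regular monomorphism it is the equalizer of these (`isLimitUnitFork`), so the given
morphism factors through β (`exists_app_lift`).

The two constructions are inverse because C and ξ determine G, `can` and g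
(`GaloisCoaction.eq_of_comp_can`), and conversely ξ is forced by `can`. -/

namespace GaloisComonad

/-! ### Regular monomorphic units of adjunctions -/

section Equalizer

variable {𝒞 : Type u₁} [Category.{v₁} 𝒞] {𝒟 : Type u₂} [Category.{v₂} 𝒟]

theorem unit_fork_condition {L : 𝒞 ⥤ 𝒟} {R : 𝒟 ⥤ 𝒞} (adj : L ⊣ R) (Y : 𝒞) :
    adj.unit.app Y ≫ adj.unit.app (R.obj (L.obj Y)) =
      adj.unit.app Y ≫ R.map (L.map (adj.unit.app Y)) :=
  adj.unit.naturality (adj.unit.app Y)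

/-- If the unit of an adjunction is a regular monomorphism of functors, then it is objectwise the
equalizer of its two canonical whiskerings. -/
noncomputable def isLimitUnitFork [HasEqualizers 𝒞] {L : 𝒞 ⥤ 𝒟} {R : 𝒟 ⥤ 𝒞} (adj : L ⊣ R)
    (h : IsRegularMono adj.unit) (Y : 𝒞) :
    IsLimit (Fork.ofι (adj.unit.app Y) (unit_fork_condition adj Y)) := by
  let r := h.getStruct
  have hp : ∀ Z : 𝒞, adj.unit.app Z ≫ r.left.app Z = adj.unit.app Z ≫ r.right.app Z :=
    fun Z => NatTrans.congr_app r.w Z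
  -- Since 𝒞 has equalizers, evaluation at an object preserves equalizers of functors.
  have hl : ∀ Z : 𝒞, IsLimit (Fork.ofι (adj.unit.app Z) (hp Z)) := fun Z =>
    isLimitForkMapOfIsLimit ((evaluation 𝒞 𝒞).obj Z) r.w r.isLimit
  have hmono : ∀ Z : 𝒞, Mono (adj.unit.app Z) := fun Z => mono_of_isLimit_fork (hl Z)
  -- The unknown parallel pair is compared with the canonical one after composing with the
  -- monomorphism η at r.Z Y: naturality moves the pair behind RL, where `hk` inserts RLη, and RLη
  -- equalizes RL of the pair.
  have key : ∀ {V : 𝒞} (k : V ⟶ R.obj (L.obj Y)),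
      k ≫ adj.unit.app (R.obj (L.obj Y)) = k ≫ R.map (L.map (adj.unit.app Y)) →
      k ≫ r.left.app Y = k ≫ r.right.app Y := by
    intro V k hk
    have n1 : r.left.app Y ≫ adj.unit.app (r.Z.obj Y) =
        adj.unit.app (R.obj (L.obj Y)) ≫ R.map (L.map (r.left.app Y)) :=
      adj.unit.naturality (r.left.app Y)
    have n2 : r.right.app Y ≫ adj.unit.app (r.Z.obj Y) =
        adj.unit.app (R.obj (L.obj Y)) ≫ R.map (L.map (r.right.app Y)) :=
      adj.unit.naturality (r.right.app Y)
    have hm : R.map (L.map (adj.unit.app Y)) ≫ R.map (L.map (r.left.app Y)) =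
        R.map (L.map (adj.unit.app Y)) ≫ R.map (L.map (r.right.app Y)) := by
      simp only [← Functor.map_comp, hp Y]
    have := hmono (r.Z.obj Y)
    rw [← cancel_mono (adj.unit.app (r.Z.obj Y)), Category.assoc, Category.assoc, n1, n2,
      reassoc_of% hk, reassoc_of% hk, hm]
  exact Fork.IsLimit.mk' _ fun s =>
    ⟨Fork.IsLimit.lift (hl Y) s.ι (key s.ι s.condition),
      Fork.IsLimit.lift_ι (hl Y), fun {m} hm => by
        have := hmono Y
        exact (cancel_mono (adj.unit.app Y)).1
          (hm.trans (Fork.IsLimit.lift_ι' (hl Y) s.ι (key s.ι s.condition)).symm)⟩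

end Equalizer

/-! ### Comonad arrows and strict liftings -/

section Comonad

variable {𝒜 : Type u₁} [Category.{v₁} 𝒜] {𝒯 : Type u₂} [Category.{v₂} 𝒯]

theorem app_comp_map_hom {D : 𝒜 ⥤ 𝒜} {P G : 𝒯 ⥤ 𝒯} {F : 𝒯 ⥤ 𝒜} {ξ : F ⋙ D ⟶ P ⋙ F} (κ : P ≅ G)
    (e : G ⋙ F = F ⋙ D) {M : 𝒯}
    (w : F.map (κ.inv.app M) = eqToHom (Functor.congr_obj e M) ≫ ξ.app M) :
    ξ.app M ≫ F.map (κ.hom.app M) = eqToHom (Functor.congr_obj e M).symm := by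
  have h : ξ.app M = eqToHom (Functor.congr_obj e M).symm ≫ F.map (κ.inv.app M) := by
    rw [w]; simp
  rw [h, Category.assoc, ← F.map_comp, Iso.inv_hom_id_app, F.map_id]
  exact Category.comp_id _

/-- Let `κ : P ≅ G` be an isomorphism of comonads that lies over the inverse of a comonad arrow
`ξ : C F ⟶ F P`, where `F G = C F`. Then `G` is a lifting of `C`. -/
theorem isLifting_of_iso {C : Comonad 𝒜} {P G : Comonad 𝒯} {F : 𝒯 ⥤ 𝒜}
    {ξ : F ⋙ C.toFunctor ⟶ P.toFunctor ⋙ F} (h : IsComonadArrow C P F ξ)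
    (κ : P.toFunctor ≅ G.toFunctor) (e : G.toFunctor ⋙ F = F ⋙ C.toFunctor)
    (hε : ∀ M, κ.hom.app M ≫ G.ε.app M = P.ε.app M)
    (hδ : ∀ M, κ.hom.app M ≫ G.δ.app M =
      P.δ.app M ≫ P.map (κ.hom.app M) ≫ κ.hom.app (G.obj M))
    (w : ∀ M, F.map (κ.inv.app M) = eqToHom (Functor.congr_obj e M) ≫ ξ.app M) :
    IsLifting F C G where
  comp_eq := e
  counit M := by
    have h1 : G.ε.app M = κ.inv.app M ≫ P.ε.app M := by rw [← hε, Iso.inv_hom_id_app_assoc]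
    rw [h1, F.map_comp, w, Category.assoc, h.counit]
  comul M := by
    -- The comultiplication of G is that of P conjugated by κ, in the order of factors that lets ξ
    -- meet κ at P M below.
    have h1 : G.δ.app M = κ.inv.app M ≫ P.δ.app M ≫ κ.hom.app (P.obj M) ≫
        G.map (κ.hom.app M) := by
      have n : κ.hom.app (P.obj M) ≫ G.map (κ.hom.app M) =
        P.map (κ.hom.app M) ≫ κ.hom.app (G.obj M) := (κ.hom.naturality _).symm
      rw [n, ← hδ, Iso.inv_hom_id_app_assoc]
    -- The equality of functors F G = C F, read on morphisms, replaces F G by C F up to `eqToHom`.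
    have h2 : F.map (G.map (κ.hom.app M)) = eqToHom (Functor.congr_obj e (P.obj M)) ≫
        C.map (F.map (κ.hom.app M)) ≫ eqToHom (Functor.congr_obj e (G.obj M)).symm :=
      Functor.congr_hom e _
    have h3 : ∀ N, ξ.app N ≫ F.map (κ.hom.app N) = eqToHom (Functor.congr_obj e N).symm :=
      fun N => app_comp_map_hom κ e (w N)
    have h4 : C.map (ξ.app M) ≫ C.map (F.map (κ.hom.app M)) =
        eqToHom (congrArg C.obj (Functor.congr_obj e M).symm) := by
      rw [← C.map_comp, h3]
      exact eqToHom_map _ _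
    have h5 := h.comul M
    rw [h1, F.map_comp, F.map_comp, F.map_comp, h2, w, Category.assoc, reassoc_of% h5,
      reassoc_of% (h3 (P.obj M)), eqToHom_trans_assoc, eqToHom_refl, Category.id_comp,
      reassoc_of% h4, eqToHom_trans]

/-- The isomorphism `C F ≅ F P` over the inverse of `κ : P ≅ G`, where `F G = C F`. -/
noncomputable def arrowOfIso {C : Comonad 𝒜} {P G : Comonad 𝒯} {F : 𝒯 ⥤ 𝒜}
    (e : G.toFunctor ⋙ F = F ⋙ C.toFunctor) (κ : P.toFunctor ≅ G.toFunctor) :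
    F ⋙ C.toFunctor ≅ P.toFunctor ⋙ F :=
  eqToIso e.symm ≪≫ Functor.isoWhiskerRight κ.symm F

theorem arrowOfIso_hom_app {C : Comonad 𝒜} {P G : Comonad 𝒯} {F : 𝒯 ⥤ 𝒜}
    (e : G.toFunctor ⋙ F = F ⋙ C.toFunctor) (κ : P.toFunctor ≅ G.toFunctor) (M : 𝒯) :
    (arrowOfIso e κ).hom.app M =
      eqToHom (Functor.congr_obj e M).symm ≫ F.map (κ.inv.app M) := by
  simp [arrowOfIso, eqToHom_app]

theorem arrowOfIso_hom_app_comp {C : Comonad 𝒜} {P G : Comonad 𝒯} {F : 𝒯 ⥤ 𝒜}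
    (e : G.toFunctor ⋙ F = F ⋙ C.toFunctor) (κ : P.toFunctor ≅ G.toFunctor) (M : 𝒯) :
    (arrowOfIso e κ).hom.app M ≫ F.map (κ.hom.app M) =
      eqToHom (Functor.congr_obj e M).symm := by
  rw [arrowOfIso_hom_app, Category.assoc, ← F.map_comp, Iso.inv_hom_id_app, F.map_id]
  exact Category.comp_id _

/-- An isomorphism `κ : P ≅ G` of comonads, where `G` is a lifting of `C`, yields a comonad arrow
from `C` to `P`. -/
theorem isComonadArrow_arrowOfIso {C : Comonad 𝒜} {P G : Comonad 𝒯} {F : 𝒯 ⥤ 𝒜}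
    (h : IsLifting F C G) (κ : P.toFunctor ≅ G.toFunctor)
    (hε : ∀ M, κ.hom.app M ≫ G.ε.app M = P.ε.app M)
    (hδ : ∀ M, κ.hom.app M ≫ G.δ.app M =
      P.δ.app M ≫ P.map (κ.hom.app M) ≫ κ.hom.app (G.obj M)) :
    IsComonadArrow C P F (arrowOfIso h.comp_eq κ).hom where
  counit M := by
    rw [arrowOfIso_hom_app, ← hε, Category.assoc, ← F.map_comp, Iso.inv_hom_id_app_assoc,
      h.counit]
    simp
  comul M := by
    have h1 : P.δ.app M = κ.hom.app M ≫ G.δ.app M ≫ G.map (κ.inv.app M) ≫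
        κ.inv.app (P.obj M) := by
      have n : G.map (κ.inv.app M) ≫ κ.inv.app (P.obj M) =
        κ.inv.app (G.obj M) ≫ P.map (κ.inv.app M) := κ.inv.naturality _
      have m : P.map (κ.hom.app M) ≫ P.map (κ.inv.app M) = 𝟙 _ := by
        rw [← P.map_comp, Iso.hom_inv_id_app, P.map_id]
      have m' : κ.hom.app (G.obj M) ≫ κ.inv.app (G.obj M) = 𝟙 _ := κ.hom_inv_id_app _
      rw [n, reassoc_of% (hδ M), reassoc_of% m', m]
      exact (Category.comp_id _).symm
    have h2 : F.map (G.map (κ.inv.app M)) = eqToHom (Functor.congr_obj h.comp_eq (G.obj M)) ≫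
        C.map (F.map (κ.inv.app M)) ≫ eqToHom (Functor.congr_obj h.comp_eq (P.obj M)).symm :=
      Functor.congr_hom h.comp_eq _
    have h4 : C.map ((arrowOfIso h.comp_eq κ).hom.app M) =
        eqToHom (congrArg C.obj (Functor.congr_obj h.comp_eq M).symm) ≫
          C.map (F.map (κ.inv.app M)) := by
      rw [arrowOfIso_hom_app, C.map_comp]
      congr 1
      exact eqToHom_map _ _
    have m : F.map (κ.inv.app M) ≫ F.map (κ.hom.app M) = 𝟙 _ := by
      rw [← F.map_comp, Iso.inv_hom_id_app, F.map_id]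
    rw [h1, F.map_comp, F.map_comp, F.map_comp, h2, h4,
      arrowOfIso_hom_app, arrowOfIso_hom_app, h.comul,
      Category.assoc, reassoc_of% m]
    simp

/-- A lifting along a faithful functor is determined by its values on objects. -/
theorem isLifting_unique {C : Comonad 𝒜} {G G' : Comonad 𝒯} {F : 𝒯 ⥤ 𝒜} [F.Faithful]
    (h : IsLifting F C G) (h' : IsLifting F C G') (e : ∀ M, G.obj M = G'.obj M) : G = G' := by
  -- On morphisms, both functors become C F after applying F, so faithfulness decides.
  have hF : G.toFunctor = G'.toFunctor := by
    refine CategoryTheory.Functor.ext e fun M N f => F.map_injective ?_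
    have h1 : F.map (G.map f) = _ := Functor.congr_hom h.comp_eq f
    have h2 : F.map (G'.map f) = _ := Functor.congr_hom h'.comp_eq f
    rw [F.map_comp, F.map_comp, h1, h2, eqToHom_map, eqToHom_map]
    simp
  obtain ⟨G, ε, δ, _, _, _⟩ := G
  obtain ⟨G', ε', δ', _, _, _⟩ := G'
  dsimp at hF
  subst hF
  have hε : ε = ε' := by
    ext M
    exact F.map_injective ((h.counit M).trans (h'.counit M).symm)
  have hδ : δ = δ' := by
    ext M
    exact F.map_injective ((h.comul M).trans (h'.comul M).symm)
  subst hε hδ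
  rfl

end Comonad

/-! ### Transport of module structures along ξ -/

section Lifting

variable {K : Type u} [Category.{v} K] {A T : CategoryTheory.Monad K}

theorem eqToHom_algebra_f {X Y : A.Algebra} (h : X = Y) :
    (eqToHom h).f = eqToHom (congrArg Monad.Algebra.A h) := by
  cases h
  rfl

/-- Restriction along α forgets part of the T-action, so equal restrictions alone do not suffice.
Here f and f' have the same underlying isomorphism of `K`, and T-linearity makes both actions the
one transported from `Z`. -/
theorem algebra_eq_of_restr_eq (α : A ⟶ T) {X Y Z : T.Algebra}
    (h : (restr α).obj X = (restr α).obj Y) (f : X ⟶ Z) (f' : Y ⟶ Z) [IsIso f]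
    (w : (restr α).map f = eqToHom h ≫ (restr α).map f') : X = Y := by
  obtain ⟨XA, a, _, _⟩ := X
  obtain ⟨YA, b, _, _⟩ := Y
  have hA : XA = YA := congrArg Monad.Algebra.A h
  subst hA
  have hf : f.f = f'.f := by
    have h1 := congrArg Monad.Algebra.Hom.f w
    rw [Monad.Algebra.comp_f, eqToHom_algebra_f] at h1
    exact h1.trans (Category.id_comp _)
  have e1 : T.map f.f ≫ Z.a = a ≫ f.f := f.h
  have e2 : T.map f'.f ≫ Z.a = b ≫ f'.f := f'.h
  have hi : IsIso f.f := inferInstanceAs (IsIso (T.forget.map f))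
  have : a ≫ f.f = b ≫ f.f := by rw [← e1, hf, e2]
  have hab : a = b := (cancel_mono f.f).1 this
  subst hab
  rfl

/-- The algebra structure on `X` transported along an isomorphism from `X` to an algebra. -/
def transportAlgebra {X : K} {M : T.Algebra} (i : X ≅ M.A) : T.Algebra where
  A := X
  a := T.map i.hom ≫ M.a ≫ i.inv
  unit := by
    have h : i.hom ≫ T.η.app M.A = T.η.app X ≫ T.map i.hom := T.η.naturality i.hom
    rw [← reassoc_of% h, Monad.Algebra.unit_assoc, i.hom_inv_id]
  assoc := by
    have h : T.map (T.map i.hom) ≫ T.μ.app M.A = T.μ.app X ≫ T.map i.hom := T.μ.naturality i.hom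
    rw [← reassoc_of% h, Monad.Algebra.assoc_assoc]
    simp only [Functor.map_comp, Category.assoc]
    rw [← T.map_comp_assoc i.inv i.hom, i.inv_hom_id]
    simp

/-- The isomorphism of algebras underlying the transport of structure. -/
def transportAlgebraIso {X : K} {M : T.Algebra} (i : X ≅ M.A) : M ≅ transportAlgebra i where
  hom :=
    { f := i.inv
      h := by
        have h : T.map i.inv ≫ T.map i.hom = 𝟙 (T.obj M.A) := by
          rw [← T.map_comp, i.inv_hom_id, T.map_id]
        exact comp_aux' h }
  inv :=
    { f := i.hom
      h := by
        have h : (T.map i.hom ≫ M.a ≫ i.inv) ≫ i.hom = T.map i.hom ≫ M.a := by simp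
        exact h.symm }
  hom_inv_id := Monad.Algebra.Hom.ext' _ _ _ _ i.inv_hom_id
  inv_hom_id := Monad.Algebra.Hom.ext' _ _ _ _ i.hom_inv_id

variable {α : A ⟶ T}

/-- The isomorphism of `K` underlying an isomorphism onto a restricted algebra. -/
def underlyingIso {Y : A.Algebra} {M : T.Algebra} (i : Y ≅ (restr α).obj M) : Y.A ≅ M.A where
  hom := i.hom.f
  inv := i.inv.f
  hom_inv_id := congrArg Monad.Algebra.Hom.f i.hom_inv_id
  inv_hom_id := congrArg Monad.Algebra.Hom.f i.inv_hom_id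

/-- The carrier is `Y.A` by construction, so only the actions must be compared. Naturality of α and
A-linearity of i turn the transported action into that of Y. Strictness of the lifting rests on this
equality. -/
theorem restr_transportAlgebra {Y : A.Algebra} {M : T.Algebra} (i : Y ≅ (restr α).obj M) :
    (restr α).obj (transportAlgebra (underlyingIso i)) = Y := by
  have e : A.map (underlyingIso i).hom ≫ α.app M.A ≫ M.a = Y.a ≫ (underlyingIso i).hom := i.hom.h
  have n : A.map (underlyingIso i).hom ≫ α.app M.A = α.app Y.A ≫ T.map (underlyingIso i).hom :=
    α.naturality _
  have h : α.app Y.A ≫ T.map (underlyingIso i).hom ≫ M.a ≫ (underlyingIso i).inv = Y.a := by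
    rw [← reassoc_of% n, reassoc_of% e, Iso.hom_inv_id, Category.comp_id]
  -- Stated for an arbitrary `Z` with a propositional equality of carriers, so that this equality
  -- can be substituted.
  have aux : ∀ (Z : T.Algebra) (hA : Z.A = Y.A)
      (_ : α.app Z.A ≫ Z.a = A.map (eqToHom hA) ≫ Y.a ≫ eqToHom hA.symm),
      (restr α).obj Z = Y := by
    obtain ⟨YA, ya, _, _⟩ := Y
    rintro ⟨ZA, za, _, _⟩ hA hz
    dsimp at hA
    subst hA
    simp at hz
    subst hz
    rfl
  refine aux _ rfl (h.trans ?_)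
  have h' : Y.a = A.map (𝟙 Y.A) ≫ Y.a ≫ 𝟙 Y.A := by simp
  exact h'

theorem restr_map_transportAlgebraIso_inv {Y : A.Algebra} {M : T.Algebra}
    (i : Y ≅ (restr α).obj M) :
    (restr α).map (transportAlgebraIso (underlyingIso i)).inv =
      eqToHom (restr_transportAlgebra i) ≫ i.hom := by
  apply Monad.Algebra.Hom.ext'
  rw [Monad.Algebra.comp_f, eqToHom_algebra_f]
  exact (Category.id_comp i.hom.f).symm

theorem restr_map_transportAlgebraIso_hom {Y : A.Algebra} {M : T.Algebra}
    (i : Y ≅ (restr α).obj M) :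
    (restr α).map (transportAlgebraIso (underlyingIso i)).hom =
      i.inv ≫ eqToHom (restr_transportAlgebra i).symm := by
  apply Monad.Algebra.Hom.ext'
  rw [Monad.Algebra.comp_f, eqToHom_algebra_f]
  exact (Category.comp_id i.inv.f).symm

variable {D : A.Algebra ⥤ A.Algebra} {P : T.Algebra ⥤ T.Algebra}
  (ξ : restr α ⋙ D ≅ P ⋙ restr α)

/-- The component of `ξ : D R ≅ R P` at `M`. -/
def isoApp (M : T.Algebra) : D.obj ((restr α).obj M) ≅ (restr α).obj (P.obj M) := ξ.app M

/-- The lifting of `D` along `R` determined by `ξ : D R ≅ R P`. -/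
def liftFunctor : T.Algebra ⥤ T.Algebra where
  obj M := transportAlgebra (underlyingIso (isoApp ξ M))
  map {M N} f := (transportAlgebraIso (underlyingIso (isoApp ξ M))).inv ≫ P.map f ≫
    (transportAlgebraIso (underlyingIso (isoApp ξ N))).hom

/-- The isomorphism from `P` to the lifting of `D` that lies over `ξ⁻¹`. -/
def liftIso : P ≅ liftFunctor ξ :=
  NatIso.ofComponents (fun M => transportAlgebraIso (underlyingIso (isoApp ξ M))) (fun _ =>
    (Iso.hom_inv_id_assoc _ _).symm)

theorem liftFunctor_comp_restr : liftFunctor ξ ⋙ restr α = restr α ⋙ D := by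
  refine CategoryTheory.Functor.ext (fun M => restr_transportAlgebra (isoApp ξ M)) fun M N f => ?_
  have h2 : D.map ((restr α).map f) ≫ (isoApp ξ N).hom =
    (isoApp ξ M).hom ≫ (restr α).map (P.map f) := ξ.hom.naturality f
  change (restr α).map ((transportAlgebraIso (underlyingIso (isoApp ξ M))).inv ≫ P.map f ≫
    (transportAlgebraIso (underlyingIso (isoApp ξ N))).hom) =
      eqToHom (restr_transportAlgebra (isoApp ξ M)) ≫ D.map ((restr α).map f) ≫
        eqToHom (restr_transportAlgebra (isoApp ξ N)).symm
  rw [Functor.map_comp, Functor.map_comp, restr_map_transportAlgebraIso_hom,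
    restr_map_transportAlgebraIso_inv, Category.assoc, ← reassoc_of% h2, Iso.hom_inv_id_assoc]

theorem restr_map_liftIso_inv (M : T.Algebra) :
    (restr α).map ((liftIso ξ).inv.app M) =
      eqToHom (Functor.congr_obj (liftFunctor_comp_restr ξ) M) ≫ ξ.hom.app M :=
  restr_map_transportAlgebraIso_inv (isoApp ξ M)

theorem transport_ε {𝒯 : Type u₁} [Category.{v₁} 𝒯] (P : Comonad 𝒯) {F : 𝒯 ⥤ 𝒯}
    (κ : P.toFunctor ≅ F) (M : 𝒯) : κ.hom.app M ≫ (P.transport κ).ε.app M = P.ε.app M :=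
  κ.hom_inv_id_app_assoc M _

theorem transport_δ {𝒯 : Type u₁} [Category.{v₁} 𝒯] (P : Comonad 𝒯) {F : 𝒯 ⥤ 𝒯}
    (κ : P.toFunctor ≅ F) (M : 𝒯) : κ.hom.app M ≫ (P.transport κ).δ.app M =
      P.δ.app M ≫ P.map (κ.hom.app M) ≫ κ.hom.app (F.obj M) := by
  have h : κ.hom.app (P.obj M) ≫ F.map (κ.hom.app M) =
    P.map (κ.hom.app M) ≫ κ.hom.app (F.obj M) := (κ.hom.naturality _).symm
  rw [← h]
  exact κ.hom_inv_id_app_assoc M _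

theorem isLifting_transport {C : Comonad A.Algebra} {P : Comonad T.Algebra}
    (ξ : restr α ⋙ C.toFunctor ≅ P.toFunctor ⋙ restr α)
    (h : IsComonadArrow C P (restr α) ξ.hom) :
    IsLifting (restr α) C (P.transport (liftIso ξ)) :=
  isLifting_of_iso h (G := P.transport (liftIso ξ)) (liftIso ξ) (liftFunctor_comp_restr ξ)
    (transport_ε P _) (transport_δ P _) (restr_map_liftIso_inv ξ)

end Lifting

/-- The chase behind both directions of coassociativity: x, x', x'' are units, c, c' are components
of κ, y, y' those of g, d is the comultiplication of N_B R_B and n is N_B R_B c. -/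
theorem comp_comul_aux {𝒞 : Type u₁} [Category.{v₁} 𝒞] {X Y Z W V P : 𝒞} {x : X ⟶ Y}
    {c : Y ⟶ Z} {y : X ⟶ Z} {d : Y ⟶ W} {x' : Y ⟶ W} {n : W ⟶ V} {x'' : Z ⟶ V} {c' : V ⟶ P}
    {y' : Z ⟶ P} (h1 : x ≫ c = y) (h2 : x ≫ d = x ≫ x') (h3 : x' ≫ n = c ≫ x'')
    (h4 : x'' ≫ c' = y') : y ≫ y' = x ≫ d ≫ n ≫ c' := by
  rw [reassoc_of% h2, reassoc_of% h3, h4, reassoc_of% h1]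

/-! ### The morphism `can` as a transpose of g -/

section CanonicalMorphism

variable {K : Type u} [Category.{v} K] {B T : CategoryTheory.Monad K}
  [HasCoequalizers K] [PreservesColimitsOfShape WalkingParallelPair T.toFunctor]

/-- The morphism of `K` underlying the unit `η^B R_B`, at `M`. -/
noncomputable def unitRestr (β : B ⟶ T) (M : T.Algebra) :
    M.A ⟶ ((induced β).obj ((restr β).obj M)).A :=
  res (χ β ((restr β).obj M))

theorem unitRestr_counit (β : B ⟶ T) (M : T.Algebra) :
    unitRestr β M ≫ ((canonicalAdj β).counit.app M).f = 𝟙 M.A :=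
  res_χ_counitApp β M

theorem unitRestr_map (β : B ⟶ T) {M N : T.Algebra} (f : M ⟶ N) :
    unitRestr β M ≫ ((induced β).map ((restr β).map f)).f = f.f ≫ unitRestr β N :=
  res_χ_map β ((restr β).map f)

/-- The comultiplication of N_B R_B is N_B η^B R_B, so this is naturality of η^B at a component of
η^B. -/
theorem unitRestr_comul (β : B ⟶ T) (M : T.Algebra) :
    unitRestr β M ≫ ((canonicalAdj β).toComonad.δ.app M).f =
      unitRestr β M ≫ unitRestr β ((induced β).obj ((restr β).obj M)) :=
  res_χ_map β (unitApp β ((restr β).obj M))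

/-- Uniqueness of transposes for N_B ⊣ R_B. -/
theorem unitRestr_ext (β : B ⟶ T) {M N : T.Algebra}
    {h k : (induced β).obj ((restr β).obj M) ⟶ N}
    (w : unitRestr β M ≫ h.f = unitRestr β M ≫ k.f) : h = k :=
  χ_ext β w

/-- Since χ ≫ can = ḡ ≫ Gλ, restricting along the unit of T leaves u ≫ g ≫ Gλ. Naturality of g at λ
moves λ to the front, where it cancels u. -/
theorem unitRestr_can {β : B ⟶ T} {G : Comonad T.Algebra}
    {g : T.forget ⟶ G.toFunctor ⋙ T.forget} (hg : IsCoinvariantMonad β g) (M : T.Algebra) :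
    unitRestr β M ≫ ((can hg).app M).f = g.app M := by
  let Y := (restr β).obj M
  let a : T.free.obj M.A ⟶ G.obj (T.free.obj M.A) := (leftCoaction T.adj G g).app M.A
  let l : T.free.obj M.A ⟶ M := lam M
  have h1 : χ β Y ≫ (inducedCoaction hg).app Y = a ≫ G.map (χ β Y) :=
    χ_desc β Y _ (inducedCoaction_aux hg Y)
  have h2 : χ β Y ≫ (canonicalAdj β).counit.app M = l := χ_desc β Y (lam M) _
  have h3 : (can hg).app M =
    (inducedCoaction hg).app Y ≫ G.map ((canonicalAdj β).counit.app M) := rfl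
  have h4 : G.map (χ β Y) ≫ G.map ((canonicalAdj β).counit.app M) = G.map l :=
    (G.map_comp _ _).symm.trans (congrArg G.map h2)
  have h5 : χ β Y ≫ (can hg).app M = a ≫ G.map l := by
    rw [h3]
    exact (Category.assoc _ _ _).symm.trans ((congrArg (fun t => t ≫ _) h1).trans
      ((Category.assoc _ _ _).trans (congrArg (fun t => a ≫ t) h4)))
  have h6 : res (a ≫ G.map l) = (T.η.app M.A ≫ g.app (T.free.obj M.A)) ≫ (G.map l).f :=
    (res_comp _ _).trans (congrArg (fun t => t ≫ (G.map l).f) (res_leftCoaction g M.A))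
  have h7 : g.app (T.free.obj M.A) ≫ (G.map l).f = und l ≫ g.app M := (g.naturality l).symm
  have h8 : T.η.app M.A ≫ und l = 𝟙 M.A := res_lam M
  exact (res_comp _ _).symm.trans ((congrArg res h5).trans (h6.trans ((Category.assoc _ _ _).trans
    ((congrArg (fun t => T.η.app M.A ≫ t) h7).trans (comp_aux' h8)))))

/-- Together with `can_comul` this makes `can` a comonad morphism: after transposition the two
identities are the counit and coassociativity laws of g. -/
theorem can_counit {β : B ⟶ T} {G : Comonad T.Algebra}
    {g : T.forget ⟶ G.toFunctor ⋙ T.forget} (hg : IsCoinvariantMonad β g)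
    (h : IsRightCoaction G T.forget g) (M : T.Algebra) :
    (can hg).app M ≫ G.ε.app M = (canonicalAdj β).counit.app M := by
  apply unitRestr_ext
  have h1 : g.app M ≫ (G.ε.app M).f = 𝟙 M.A := h.counit M
  refine Eq.trans ?_ (h1.trans (unitRestr_counit β M).symm)
  rw [← unitRestr_can hg M]
  exact (Category.assoc _ _ _).symm

theorem can_comul {β : B ⟶ T} {G : Comonad T.Algebra}
    {g : T.forget ⟶ G.toFunctor ⋙ T.forget} (hg : IsCoinvariantMonad β g)
    (h : IsRightCoaction G T.forget g) (M : T.Algebra) :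
    (can hg).app M ≫ G.δ.app M = (canonicalAdj β).toComonad.δ.app M ≫
      (canonicalAdj β).toComonad.map ((can hg).app M) ≫ (can hg).app (G.obj M) := by
  apply unitRestr_ext
  have h1 : g.app M ≫ (G.δ.app M).f = g.app M ≫ g.app (G.obj M) := h.coassoc M
  have h2 := unitRestr_comul β M
  have h3 := unitRestr_map β ((can hg).app M)
  have e1 : unitRestr β M ≫ ((can hg).app M).f ≫ (G.δ.app M).f = g.app M ≫ (G.δ.app M).f :=
    (Category.assoc _ _ _).symm.trans (congrArg (fun t => t ≫ (G.δ.app M).f) (unitRestr_can hg M))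
  exact e1.trans (h1.trans (comp_comul_aux (unitRestr_can hg M) h2 h3 (unitRestr_can hg (G.obj M))))

end CanonicalMorphism

/-! ### Free modules: comparing F_T with N_B F_B -/

section FreeModules

variable {K : Type u} [Category.{v} K] {B T : CategoryTheory.Monad K}
  [HasCoequalizers K] [PreservesColimitsOfShape WalkingParallelPair T.toFunctor]

/-- The component `β X`, as a morphism of `B`-modules out of the free one. -/
def freeComparison (β : B ⟶ T) (X : K) : B.free.obj X ⟶ (restr β).obj (T.free.obj X) where
  f := β.app X
  h := by
    change B.map (β.app X) ≫ β.app (T.obj X) ≫ T.μ.app X = B.μ.app X ≫ β.app X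
    simp

/-- The `B`-module unit `η^B F_B`, as a morphism of `K`, at `X`. -/
noncomputable def unitFree (β : B ⟶ T) (X : K) :
    B.obj X ⟶ ((induced β).obj (B.free.obj X)).A :=
  res (χ β (B.free.obj X))

/-- The canonical morphism `F_T ⟶ N_B F_B`, at `X`. -/
noncomputable def freeToInduced (β : B ⟶ T) (X : K) :
    T.free.obj X ⟶ (induced β).obj (B.free.obj X) :=
  T.free.map (B.η.app X) ≫ χ β (B.free.obj X)

/-- The canonical morphism `N_B F_B ⟶ F_T`, at `X`. -/
noncomputable def inducedToFree (β : B ⟶ T) (X : K) :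
    (induced β).obj (B.free.obj X) ⟶ T.free.obj X :=
  ((canonicalAdj β).homEquiv _ _).symm (freeComparison β X)

theorem res_freeToInduced (β : B ⟶ T) (X : K) :
    res (freeToInduced β X) = B.η.app X ≫ unitFree β X :=
  res_map_comp _ _

theorem unitFree_inducedToFree (β : B ⟶ T) (X : K) :
    unitFree β X ≫ (inducedToFree β X).f = β.app X := by
  have h : (canonicalAdj β).homEquiv _ _ (inducedToFree β X) = freeComparison β X :=
    Equiv.apply_symm_apply _ _
  rw [Adjunction.homEquiv_unit] at h
  exact congrArg Monad.Algebra.Hom.f h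

theorem freeToInduced_inducedToFree (β : B ⟶ T) (X : K) :
    freeToInduced β X ≫ inducedToFree β X = 𝟙 _ := by
  apply res_injective
  refine (res_comp _ _).trans ?_
  rw [res_freeToInduced]
  refine (Category.assoc _ _ _).trans
    ((congrArg (fun t => B.η.app X ≫ t) (unitFree_inducedToFree β X)).trans ((β.app_η X).trans ?_))
  exact (Category.comp_id _).symm

/-- Both sides underlie B-linear maps out of a free B-module, so they may be compared on generators.
-/
theorem app_freeToInduced (β : B ⟶ T) (X : K) :
    β.app X ≫ (freeToInduced β X).f = unitFree β X := by
  have h : freeComparison β X ≫ (restr β).map (freeToInduced β X) =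
      (canonicalAdj β).unit.app (B.free.obj X) := by
    apply res_injective
    have h1 : res (freeComparison β X) = T.η.app X := β.app_η X
    refine (res_comp _ _).trans ?_
    rw [h1]
    exact res_freeToInduced β X
  exact congrArg Monad.Algebra.Hom.f h

theorem app_unitRestr (β : B ⟶ T) (X : K) :
    β.app X ≫ unitRestr β (T.free.obj X) =
      unitFree β X ≫ ((induced β).map (freeComparison β X)).f :=
  (res_χ_map β (freeComparison β X)).symm

/-- The forgetful functor of B-modules preserves equalizers, so the equalizer property of η^B at a
free module passes to `K`. The same holds for `exists_unitFree_lift`. -/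
theorem unitFree_ext [HasEqualizers K] {β : B ⟶ T} (hη : IsRegularMono (canonicalAdj β).unit)
    {X V : K} {h k : V ⟶ B.obj X} (w : h ≫ unitFree β X = k ≫ unitFree β X) : h = k := by
  have : HasEqualizers B.Algebra :=
    hasLimitsOfShape_of_hasLimitsOfShape_createsLimitsOfShape B.forget
  have : Mono (unitFree β X) := mono_of_isLimit_fork
    (isLimitForkMapOfIsLimit B.forget _ (isLimitUnitFork (canonicalAdj β) hη (B.free.obj X)))
  exact (cancel_mono (unitFree β X)).1 w

theorem exists_unitFree_lift [HasEqualizers K] {β : B ⟶ T}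
    (hη : IsRegularMono (canonicalAdj β).unit) {X V : K} (k : V ⟶ ((induced β).obj (B.free.obj X)).A)
    (w : k ≫ unitRestr β ((induced β).obj (B.free.obj X)) =
      k ≫ ((induced β).map ((canonicalAdj β).unit.app (B.free.obj X))).f) :
    ∃ l : V ⟶ B.obj X, l ≫ unitFree β X = k := by
  have : HasEqualizers B.Algebra :=
    hasLimitsOfShape_of_hasLimitsOfShape_createsLimitsOfShape B.forget
  have hl := isLimitForkMapOfIsLimit B.forget _
    (isLimitUnitFork (canonicalAdj β) hη (B.free.obj X))
  exact ⟨Fork.IsLimit.lift hl k w, Fork.IsLimit.lift_ι' hl k w⟩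

end FreeModules

/-! ### B as the coinvariants of the coaction defined by κ -/

section Coinvariants

variable {K : Type u} [Category.{v} K] {B T : CategoryTheory.Monad K}
  [HasCoequalizers K] [PreservesColimitsOfShape WalkingParallelPair T.toFunctor]
  {β : B ⟶ T} {G : Comonad T.Algebra}

/-- The morphism `(U_T κ) ∘ (U_B η^B R_B) : U_T ⟶ U_T G` associated to `κ : N_B R_B ⟶ G`. -/
noncomputable def coactionOf (κ : (canonicalAdj β).toComonad.toFunctor ⟶ G.toFunctor) :
    T.forget ⟶ G.toFunctor ⋙ T.forget where
  app M := unitRestr β M ≫ (κ.app M).f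
  naturality M N f := by
    have h1 := unitRestr_map β f
    have h2 : ((induced β).map ((restr β).map f)).f ≫ (κ.app N).f =
      (κ.app M).f ≫ (G.map f).f := congrArg Monad.Algebra.Hom.f (κ.naturality f)
    have aux : ∀ {X₁ X₂ Y₁ Y₂ Z₁ Z₂ : K} {f : X₁ ⟶ X₂} {u₁ : X₁ ⟶ Y₁} {u₂ : X₂ ⟶ Y₂} {n : Y₁ ⟶ Y₂}
        {c₁ : Y₁ ⟶ Z₁} {c₂ : Y₂ ⟶ Z₂} {m : Z₁ ⟶ Z₂} (_ : u₁ ≫ n = f ≫ u₂) (_ : n ≫ c₂ = c₁ ≫ m),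
        f ≫ u₂ ≫ c₂ = (u₁ ≫ c₁) ≫ m := by
      intro _ _ _ _ _ _ f u₁ u₂ n c₁ c₂ m e1 e2
      rw [← reassoc_of% e1, e2, Category.assoc]
    exact aux h1 h2

variable (κ : (canonicalAdj β).toComonad.toFunctor ⟶ G.toFunctor)

theorem isRightCoaction_coactionOf
    (hε : ∀ M, κ.app M ≫ G.ε.app M = (canonicalAdj β).toComonad.ε.app M)
    (hδ : ∀ M, κ.app M ≫ G.δ.app M = (canonicalAdj β).toComonad.δ.app M ≫
      (canonicalAdj β).toComonad.map (κ.app M) ≫ κ.app (G.obj M)) :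
    IsRightCoaction G T.forget (coactionOf κ) where
  counit M := by
    have h : (κ.app M).f ≫ (G.ε.app M).f = ((canonicalAdj β).counit.app M).f :=
      congrArg Monad.Algebra.Hom.f (hε M)
    exact (Category.assoc _ _ _).trans ((congrArg (fun t => unitRestr β M ≫ t) h).trans
      (unitRestr_counit β M))
  coassoc M := by
    have h : (κ.app M).f ≫ (G.δ.app M).f = ((canonicalAdj β).toComonad.δ.app M).f ≫
        ((induced β).map ((restr β).map (κ.app M))).f ≫ (κ.app (G.obj M)).f :=
      congrArg Monad.Algebra.Hom.f (hδ M)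
    exact (Category.assoc _ _ _).trans ((congrArg (fun t => unitRestr β M ≫ t) h).trans
      (comp_comul_aux rfl (unitRestr_comul β M) (unitRestr_map β (κ.app M)) rfl).symm)

theorem leftCoaction_coactionOf (X : K) :
    (leftCoaction T.adj G (coactionOf κ)).app X =
      freeToInduced β X ≫ (induced β).map (freeComparison β X) ≫ κ.app (T.free.obj X) := by
  apply res_injective
  rw [res_leftCoaction]
  have h1 := app_unitRestr β X
  have h2 := β.app_η X
  have h3 : res (freeToInduced β X ≫ (induced β).map (freeComparison β X) ≫
      κ.app (T.free.obj X)) = (B.η.app X ≫ unitFree β X) ≫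
        ((induced β).map (freeComparison β X)).f ≫ (κ.app (T.free.obj X)).f :=
    (res_comp _ _).trans (congrArg (fun t => t ≫ _) (res_freeToInduced β X))
  have aux : ∀ {X₁ X₂ X₃ X₄ X₅ X₆ : K} {e : X₁ ⟶ X₂} {b : X₂ ⟶ X₃} {t : X₁ ⟶ X₃} {r : X₃ ⟶ X₄}
      {y : X₂ ⟶ X₅} {n : X₅ ⟶ X₄} {c : X₄ ⟶ X₆} (_ : b ≫ r = y ≫ n) (_ : e ≫ b = t),
      t ≫ r ≫ c = (e ≫ y) ≫ n ≫ c := by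
    intro _ _ _ _ _ _ e b t r y n c e1 e2
    rw [← e2, Category.assoc, Category.assoc, reassoc_of% e1]
  exact (aux h1 h2).trans h3.symm

theorem app_coactionOf (X : K) :
    β.app X ≫ (coactionOf κ).app (T.free.obj X) =
      β.app X ≫ ((leftCoaction T.adj G (coactionOf κ)).app X).f := by
  rw [leftCoaction_coactionOf]
  have h1 := app_unitRestr β X
  have h2 := app_freeToInduced β X
  have aux : ∀ {X₂ X₃ X₄ X₅ X₆ : K} {b : X₂ ⟶ X₃} {r : X₃ ⟶ X₄} {i : X₃ ⟶ X₅}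
      {y : X₂ ⟶ X₅} {n : X₅ ⟶ X₄} {c : X₄ ⟶ X₆} (_ : b ≫ r = y ≫ n) (_ : b ≫ i = y),
      b ≫ r ≫ c = b ≫ i ≫ n ≫ c := by
    intro _ _ _ _ _ b r i y n c e1 e2
    rw [reassoc_of% e1, reassoc_of% e2]
  exact aux h1 h2

/-- This is the existence half of the equalizer property of β, and it is where invertibility of κ
enters. -/
theorem exists_app_lift [HasEqualizers K] (hη : IsRegularMono (canonicalAdj β).unit) [IsIso κ]
    {X V : K} (k : V ⟶ T.obj X) (w : k ≫ (coactionOf κ).app (T.free.obj X) =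
      k ≫ ((leftCoaction T.adj G (coactionOf κ)).app X).f) :
    ∃ l : V ⟶ B.obj X, l ≫ β.app X = k := by
  rw [leftCoaction_coactionOf] at w
  have hκ : (κ.app (T.free.obj X)).f ≫ ((inv κ).app (T.free.obj X)).f = 𝟙 _ :=
    congrArg Monad.Algebra.Hom.f (NatTrans.congr_app (IsIso.hom_inv_id κ) (T.free.obj X))
  -- Cancel κ, which ends both sides of `w`.
  have h1 : k ≫ unitRestr β (T.free.obj X) =
      k ≫ (freeToInduced β X).f ≫ ((induced β).map (freeComparison β X)).f := by
    have aux : ∀ {X₁ X₂ X₃ X₄ X₅ : K} {k : X₁ ⟶ X₂} {r : X₂ ⟶ X₃} {i : X₂ ⟶ X₄} {n : X₄ ⟶ X₃}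
        {c : X₃ ⟶ X₅} {c' : X₅ ⟶ X₃} (_ : c ≫ c' = 𝟙 X₃) (_ : k ≫ r ≫ c = k ≫ i ≫ n ≫ c),
        k ≫ r = k ≫ i ≫ n := by
      intro _ _ _ _ _ k r i n c c' e1 e2
      have := congrArg (fun t => t ≫ c') e2
      simpa [e1] using this
    exact aux hκ w
  have h2 := unitRestr_map β (freeToInduced β X)
  -- N_B applied to `app_freeToInduced`.
  have h3 : (induced β).map (freeComparison β X) ≫
      (induced β).map ((restr β).map (freeToInduced β X)) =
        (induced β).map ((canonicalAdj β).unit.app (B.free.obj X)) := by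
    rw [← Functor.map_comp]
    exact congrArg (induced β).map (Monad.Algebra.Hom.ext' _ _ _ _ (app_freeToInduced β X))
  have h4 : ((induced β).map (freeComparison β X)).f ≫
      ((induced β).map ((restr β).map (freeToInduced β X))).f =
        ((induced β).map ((canonicalAdj β).unit.app (B.free.obj X))).f :=
    congrArg Monad.Algebra.Hom.f h3
  -- Composing `h1` with N_B R_B of `freeToInduced` moves the problem from F_T X to N_B F_B X, where
  -- the condition is the one for lifting through η^B.
  have h5 : (k ≫ (freeToInduced β X).f) ≫ unitRestr β ((induced β).obj (B.free.obj X)) =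
      (k ≫ (freeToInduced β X).f) ≫
        ((induced β).map ((canonicalAdj β).unit.app (B.free.obj X))).f := by
    have aux : ∀ {X₁ X₂ X₃ X₄ X₅ : K} {k : X₁ ⟶ X₂} {r : X₂ ⟶ X₃} {i : X₂ ⟶ X₄} {n : X₄ ⟶ X₃}
        {m : X₃ ⟶ X₅} {r' : X₄ ⟶ X₅} {p : X₄ ⟶ X₅} (_ : k ≫ r = k ≫ i ≫ n)
        (_ : r ≫ m = i ≫ r') (_ : n ≫ m = p), (k ≫ i) ≫ r' = (k ≫ i) ≫ p := by
      intro _ _ _ _ _ k r i n m r' p e1 e2 e3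
      rw [Category.assoc, ← e2, reassoc_of% e1, e3, Category.assoc]
    exact aux h1 h2 h4
  obtain ⟨l, hl⟩ := exists_unitFree_lift hη _ h5
  refine ⟨l, ?_⟩
  have h6 : (freeToInduced β X).f ≫ (inducedToFree β X).f = 𝟙 (T.obj X) :=
    congrArg Monad.Algebra.Hom.f (freeToInduced_inducedToFree β X)
  have aux : ∀ {X₁ X₂ X₃ X₄ : K} {l : X₁ ⟶ X₂} {y : X₂ ⟶ X₃} {j : X₃ ⟶ X₄} {b : X₂ ⟶ X₄}
      {k : X₁ ⟶ X₄} {i : X₄ ⟶ X₃} (_ : l ≫ y = k ≫ i) (_ : y ≫ j = b) (_ : i ≫ j = 𝟙 X₄),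
      l ≫ b = k := by
    intro _ _ _ _ l y j b k i e1 e2 e3
    rw [← e2, reassoc_of% e1, e3, Category.comp_id]
  exact aux hl (unitFree_inducedToFree β X) h6

theorem mono_app [HasEqualizers K] (hη : IsRegularMono (canonicalAdj β).unit) (X : K) :
    Mono (β.app X) := ⟨fun h k w => unitFree_ext hη (by
      rw [← app_freeToInduced]
      exact (Category.assoc _ _ _).symm.trans
        ((congrArg (fun t => t ≫ (freeToInduced β X).f) w).trans (Category.assoc _ _ _)))⟩

theorem isCoinvariantMonad_coactionOf [HasEqualizers K]
    (hη : IsRegularMono (canonicalAdj β).unit) [IsIso κ] :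
    IsCoinvariantMonad β (coactionOf κ) := by
  refine ⟨NatTrans.ext (funext fun X => app_coactionOf κ X), ⟨Fork.IsLimit.mk' _ fun s => ?_⟩⟩
  have hw : ∀ X, s.ι.app X ≫ (coactionOf κ).app (T.free.obj X) =
      s.ι.app X ≫ ((leftCoaction T.adj G (coactionOf κ)).app X).f :=
    fun X => NatTrans.congr_app s.condition X
  -- The lifts are chosen objectwise; monomorphy of the components of β then forces naturality and
  -- uniqueness.
  choose l hl using fun X => exists_app_lift κ hη (s.ι.app X) (hw X)
  have hmono := mono_app (β := β) hη
  refine ⟨{ app := l, naturality := fun X Y f => ?_ }, NatTrans.ext (funext hl), fun {m} hm => ?_⟩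
  · have h1 : s.pt.map f ≫ s.ι.app Y = s.ι.app X ≫ T.map f := s.ι.naturality f
    have h2 : B.map f ≫ β.app Y = β.app X ≫ T.map f := β.naturality f
    have h3 : s.pt.map f ≫ l Y = l X ≫ B.map f := by
      rw [← cancel_mono (β.app Y), Category.assoc, Category.assoc, hl, h1, h2, ← hl X,
        Category.assoc]
    exact h3
  · refine NatTrans.ext (funext fun X => (cancel_mono (β.app X)).1 ?_)
    exact (NatTrans.congr_app hm X).trans (hl X).symm

theorem can_coactionOf (hg : IsCoinvariantMonad β (coactionOf κ)) : can hg = κ :=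
  NatTrans.ext (funext fun M => unitRestr_ext β (unitRestr_can hg M))

end Coinvariants

/-! ### The bijection -/

section Correspondence

variable {K : Type u} [Category.{v} K] [HasCoequalizers K] {A B T : CategoryTheory.Monad K}
  {α : A ⟶ T} {β : B ⟶ T} [PreservesColimitsOfShape WalkingParallelPair T.toFunctor]

instance faithful_restr : (restr α).Faithful where
  map_injective {_ _ f g} h := by
    apply Monad.Algebra.Hom.ext'
    have h' : ((restr α).map f).f = ((restr α).map g).f := by rw [h]
    exact h'

/-- The canonical isomorphism of a Galois coaction. -/
noncomputable def GaloisCoaction.canIso (z : GaloisCoaction α β) :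
    (canonicalAdj β).toComonad.toFunctor ≅ z.G.toFunctor :=
  @asIso _ _ _ _ (can z.isCoinvariant) z.isIso_can

theorem GaloisCoaction.obj_eq (z : GaloisCoaction α β) (M : T.Algebra) :
    (restr α).obj (z.G.obj M) = z.C.obj ((restr α).obj M) :=
  Functor.congr_obj z.isLifting.comp_eq M

/-- The object of `RArr(K_A, K_B)` associated to a Galois coaction. -/
noncomputable def GaloisCoaction.toRArrOver (z : GaloisCoaction α β) :
    RArrOver (canonicalAdj α) (canonicalAdj β) where
  C := z.C
  ξ := (arrowOfIso z.isLifting.comp_eq z.canIso).hom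
  isComonadArrow := isComonadArrow_arrowOfIso z.isLifting z.canIso
    (can_counit z.isCoinvariant z.isRightCoaction) (can_comul z.isCoinvariant z.isRightCoaction)
  isRegular := inferInstance

/-- A Galois coaction is determined by its comonad on `K_A` and by the inverse of `R_A can`. -/
theorem GaloisCoaction.eq_of_comp_can {z z' : GaloisCoaction α β} (hC : z.C = z'.C)
    (ξ : ∀ M : T.Algebra, z.C.obj ((restr α).obj M) ⟶
      (restr α).obj ((induced β).obj ((restr β).obj M)))
    (hξ : ∀ M, IsIso (ξ M))
    (h : ∀ M, ξ M ≫ (restr α).map ((can z.isCoinvariant).app M) = eqToHom (z.obj_eq M).symm)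
    (h' : ∀ M, ξ M ≫ (restr α).map ((can z'.isCoinvariant).app M) =
      eqToHom ((congrArg (fun C : Comonad A.Algebra => C.obj ((restr α).obj M)) hC).trans
        (z'.obj_eq M).symm)) : z = z' := by
  have e : ∀ M, (restr α).obj (z.G.obj M) = (restr α).obj (z'.G.obj M) := fun M =>
    (z.obj_eq M).trans ((congrArg (fun C : Comonad A.Algebra => C.obj ((restr α).obj M)) hC).trans
      (z'.obj_eq M).symm)
  -- Both canonical morphisms lie over the inverse of the same ξ, so they agree up to the
  -- identification of their targets.
  have hc : ∀ M, (restr α).map ((can z'.isCoinvariant).app M) =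
      (restr α).map ((can z.isCoinvariant).app M) ≫ eqToHom (e M) := by
    intro M
    rw [← cancel_epi (ξ M), h', reassoc_of% (h M), eqToHom_trans]
  have hG : ∀ M, z.G.obj M = z'.G.obj M := by
    intro M
    -- The inverses of the canonical morphisms have the common target N_B R_B M, as the comparison
    -- of actions requires.
    refine algebra_eq_of_restr_eq α (e M) (z.canIso.inv.app M) (z'.canIso.inv.app M) ?_
    have hc' : (restr α).mapIso (z'.canIso.app M) =
        (restr α).mapIso (z.canIso.app M) ≪≫ eqToIso (e M) := Iso.ext (hc M)
    have h1 := congrArg (fun t => eqToHom (e M) ≫ t) (congrArg Iso.inv hc')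
    dsimp only [Iso.trans_inv, eqToIso.inv] at h1
    rw [eqToHom_trans_assoc, eqToHom_refl, Category.id_comp] at h1
    exact h1.symm
  obtain ⟨C, G, hl, g, hr, hi, hcan⟩ := z
  obtain ⟨C', G', hl', g', hr', hi', hcan'⟩ := z'
  dsimp only at hC
  subst hC
  have hGG : G = G' := isLifting_unique hl hl' hG
  subst hGG
  have hg : g = g' := by
    refine NatTrans.ext (funext fun M => ?_)
    -- Each coaction is recovered from its canonical morphism, and faithfulness of R_A identifies
    -- the latter.
    rw [← unitRestr_can hi M, ← unitRestr_can hi' M]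
    have h1 : can hi' = can hi := NatTrans.ext (funext fun N => (restr α).map_injective
      ((hc N).trans (Category.comp_id _)))
    rw [h1]
  subst hg
  rfl

namespace RArrOver

variable (x : RArrOver (canonicalAdj α) (canonicalAdj β))

instance : IsIso x.ξ := x.isRegular

/-- The lifting of `C` to `K_T` determined by `ξ`. -/
noncomputable def G : Comonad T.Algebra :=
  (canonicalAdj β).toComonad.transport (liftIso (asIso x.ξ))

/-- The isomorphism from `N_B R_B` to the functor underlying the lifting of `C`. -/
noncomputable def κ : (canonicalAdj β).toComonad.toFunctor ≅ x.G.toFunctor :=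
  liftIso (asIso x.ξ)

theorem isLifting : IsLifting (restr α) x.C x.G :=
  isLifting_transport (asIso x.ξ) x.isComonadArrow

theorem ξ_comp_κ (M : T.Algebra) : x.ξ.app M ≫ (restr α).map (x.κ.hom.app M) =
    eqToHom (Functor.congr_obj x.isLifting.comp_eq M).symm :=
  app_comp_map_hom x.κ x.isLifting.comp_eq (restr_map_liftIso_inv (asIso x.ξ) M)

/-- The Galois coaction associated to an object of `RArr(K_A, K_B)`. -/
noncomputable def toGaloisCoaction [HasEqualizers K] (hη : IsRegularMono (canonicalAdj β).unit)
    (x : RArrOver (canonicalAdj α) (canonicalAdj β)) : GaloisCoaction α β where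
  C := x.C
  G := x.G
  isLifting := x.isLifting
  g := coactionOf x.κ.hom
  isRightCoaction := isRightCoaction_coactionOf x.κ.hom
    (transport_ε (canonicalAdj β).toComonad (liftIso (asIso x.ξ)))
    (transport_δ (canonicalAdj β).toComonad (liftIso (asIso x.ξ)))
  isCoinvariant := isCoinvariantMonad_coactionOf x.κ.hom hη
  isIso_can := by
    rw [can_coactionOf]
    exact inferInstanceAs (IsIso x.κ.hom)

variable [HasEqualizers K] (hη : IsRegularMono (canonicalAdj β).unit)

theorem ξ_comp_can (M : T.Algebra) : x.ξ.app M ≫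
    (restr α).map ((can (x.toGaloisCoaction hη).isCoinvariant).app M) =
      eqToHom ((x.toGaloisCoaction hη).obj_eq M).symm := by
  have h : can (x.toGaloisCoaction hη).isCoinvariant = x.κ.hom := can_coactionOf _ _
  rw [h]
  exact x.ξ_comp_κ M

theorem toGaloisCoaction_injective :
    Function.Injective (toGaloisCoaction (α := α) hη) := by
  intro x y hxy
  -- The type of ξ depends on C, hence the heterogeneous equality. For a fixed Galois coaction, ξ is
  -- determined by cancelling R_A can.
  have aux : ∀ (z z' : GaloisCoaction α β) (_ : z = z')
      (ξ : restr α ⋙ z.C.toFunctor ⟶ (canonicalAdj β).toComonad.toFunctor ⋙ restr α)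
      (ξ' : restr α ⋙ z'.C.toFunctor ⟶ (canonicalAdj β).toComonad.toFunctor ⋙ restr α)
      (_ : ∀ M, ξ.app M ≫ (restr α).map ((can z.isCoinvariant).app M) =
        eqToHom (z.obj_eq M).symm)
      (_ : ∀ M, ξ'.app M ≫ (restr α).map ((can z'.isCoinvariant).app M) =
        eqToHom (z'.obj_eq M).symm), z.C = z'.C ∧ HEq ξ ξ' := by
    rintro z _ rfl ξ ξ' h h'
    refine ⟨rfl, heq_of_eq (NatTrans.ext (funext fun M => ?_))⟩
    have : Mono ((restr α).map ((can z.isCoinvariant).app M)) :=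
      inferInstanceAs (Mono ((restr α).mapIso (z.canIso.app M)).hom)
    exact (cancel_mono ((restr α).map ((can z.isCoinvariant).app M))).1 ((h M).trans (h' M).symm)
  obtain ⟨hC, hξ⟩ := aux _ _ hxy x.ξ y.ξ (x.ξ_comp_can hη) (y.ξ_comp_can hη)
  obtain ⟨C, ξ, _, _⟩ := x
  obtain ⟨C', ξ', _, _⟩ := y
  change C = C' at hC
  subst hC
  obtain rfl := eq_of_heq hξ
  rfl

theorem toGaloisCoaction_toRArrOver (z : GaloisCoaction α β) :
    z.toRArrOver.toGaloisCoaction hη = z :=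
  GaloisCoaction.eq_of_comp_can rfl (fun M => z.toRArrOver.ξ.app M)
    (fun M => inferInstanceAs (IsIso ((arrowOfIso z.isLifting.comp_eq z.canIso).hom.app M)))
    (z.toRArrOver.ξ_comp_can hη) (arrowOfIso_hom_app_comp z.isLifting.comp_eq z.canIso)

/-- The correspondence between the objects of `RArr(K_A, K_B)` over the canonical adjunctions and
the Galois coactions. -/
noncomputable def equivGaloisCoaction :
    RArrOver (canonicalAdj α) (canonicalAdj β) ≃ GaloisCoaction α β where
  toFun := toGaloisCoaction hη
  invFun := GaloisCoaction.toRArrOver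
  -- An injective map with a right inverse is inverted by it.
  left_inv _ := toGaloisCoaction_injective hη (toGaloisCoaction_toRArrOver hη _)
  right_inv := toGaloisCoaction_toRArrOver hη

end RArrOver

end Correspondence

end GaloisComonad

theorem theorem3p11 {K : Type u} [Category.{v} K] [HasEqualizers K] [HasCoequalizers K]
    {A B T : CategoryTheory.Monad K} (α : A ⟶ T) (β : B ⟶ T)
    [PreservesColimitsOfShape WalkingParallelPair A.toFunctor]
    [PreservesColimitsOfShape WalkingParallelPair T.toFunctor]
    (hη : IsRegularMono (GaloisComonad.canonicalAdj β).unit) :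
    ∃ e : GaloisComonad.RArrOver (GaloisComonad.canonicalAdj α) (GaloisComonad.canonicalAdj β) ≃
        GaloisComonad.GaloisCoaction α β,
      ∀ x : GaloisComonad.RArrOver (GaloisComonad.canonicalAdj α) (GaloisComonad.canonicalAdj β),
        (e x).C = x.C ∧
        (∃ h : ∀ M : T.Algebra, x.C.obj ((GaloisComonad.restr α).obj M) =
            (GaloisComonad.restr α).obj ((e x).G.obj M),
          ∀ M : T.Algebra,
            x.ξ.app M ≫ (GaloisComonad.restr α).map
              ((GaloisComonad.can (e x).isCoinvariant).app M) = eqToHom (h M)) ∧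
        ∀ M : T.Algebra, (e x).g.app M =
          ((GaloisComonad.canonicalAdj β).unit.app ((GaloisComonad.restr β).obj M)).f ≫
            ((GaloisComonad.can (e x).isCoinvariant).app M).f := by
  refine ⟨GaloisComonad.RArrOver.equivGaloisCoaction hη, fun x => ⟨rfl,
    ⟨fun M => ((x.toGaloisCoaction hη).obj_eq M).symm, x.ξ_comp_can hη⟩, fun M => ?_⟩⟩
  -- `unitRestr` is by definition the morphism underlying η^B R_B.
  exact (GaloisComonad.unitRestr_can (x.toGaloisCoaction hη).isCoinvariant M).symm
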